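/- **Setting.** Let $\mathcal E_0$ be a real Hilbert space with an orthonormal basis $(e_j)_{j\ge 0}$ and let $A$ be the positive self-adjoint operator in $\mathcal E_0$ with $Ae_j=\lambda_j e_j$, $\lambda_j>0$ (for instance $\mathcal E_0=L^2(\mathbb R,dt)$). For $p\ge 0$ put $|f|_p=|A^pf|_0$, $\mathcal E_p=\{f\in\mathcal E_0: |f|_p<\infty\}$, and let $\mathcal E=\bigcap_{p\ge 0}\mathcal E_p$ carry the projective limit topology; $\mathcal E_c$ is the complexification of $\mathcal E$, with the norms $|\cdot|_p$ extended to it. For $q>p\ge 0$ the squared Hilbert–Schmidt norm of the inclusion $i_{q,p}:\mathcal E_q\to\mathcal E_p$ is $\|i_{q,p}\|_{HS}^2=\sum_{j}\lambda_j^{-2(q-p)}\in[0,\infty]$. For $l,m\ge 0$ let $(\mathcal E_c^{\otimes(l+m)})^*_{symm}$ be the space of continuous linear functionals on $\mathcal E_c^{\otimes(l+m)}$, i.e. continuous $(l+m)$-linear forms on $\mathcal E_c$, which are symmetric in the first $l$ and, separately, in the last $m$ arguments. For such $\kappa$ and $s_1,s_2\in\mathbb R$ let $$|\kappa|_{s_1,s_2}^2=|(A^{s_1})^{\otimes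 l}\otimes(A^{s_2})^{\otimes m}\kappa|_0^2=\sum_{i\in\mathbb N^l,\ j\in\mathbb N^m}\ \prod_{a=1}^{l}\lambda_{i_a}^{2s_1}\prod_{b=1}^{m}\lambda_{j_b}^{2s_2}\ |\langle\kappa,e_{i_1}\otimes\cdots\otimes e_{i_l}\otimes e_{j_1}\otimes\cdots\otimes e_{j_m}\rangle|^2 \in[0,\infty].$$ Let $C_{+,1/2}$ be the set of positive continuous functions $u$ on $[0,\infty)$ with $\lim_{r\to\infty}\log u(r)/\sqrt r=\infty$. For $u\in C_{+,1/2}$ let $u^*(r)=\sup_{s\ge 0}e^{2\sqrt{rs}}/u(s)$ for $r\ge 0$, and let $\ell_{u^*}(t)=\inf_{r>0}u^*(r)/r^t$ for $t\ge 0$. A function on $\mathcal E_c\times\mathcal E_c$ is entire if it is continuous and its restriction to every complex line is holomorphic. **Lemma 3.1.** Let $u_1,u_2\in C_{+,1/2}$, $p_1,p_2>0$, $K_1,K_2\ge 0$, $C\in\mathbb R$, and let $F$ be an entire function on $\mathcal E_c\times\mathcal E_c$ with $$|F(\xi,\eta)|^2\le C\,u_1^*(K_1|\xi|_{p_1}^2)\,u_2^*(K_2|\eta|_{p_2}^2)\qquad(\xi,\eta\in\mathcal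 E_c).$$ Then there are kernels $\kappa_{l,m}\in(\mathcal E_c^{\otimes(l+m)})^*_{symm}$, $l,m\ge 0$, such that for all $\xi,\eta\in\mathcal E_c$ $$F(\xi,\eta)=\sum_{l,m=0}^\infty\langle\kappa_{l,m},\xi^{\otimes l}\otimes\eta^{\otimes m}\rangle$$ with unconditional convergence, and such that for all $q_1>p_1$ and $q_2>p_2$ with $\|i_{q_i,p_i}\|_{HS}<\infty$ and $K_ie^2\|i_{q_i,p_i}\|_{HS}^2<1$ $(i=1,2)$ and all $l,m\ge 0$ $$|\kappa_{l,m}|_{-q_1,-q_2}^2\le C\,\bigl(K_1e^2\|i_{q_1,p_1}\|_{HS}^2\bigr)^l\bigl(K_2e^2\|i_{q_2,p_2}\|_{HS}^2\bigr)^m\,\ell_{u_1^*}(l)\,\ell_{u_2^*}(m)$$ (with the convention $0^0=1$). -/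

import Mathlib

open scoped NNReal ENNReal TensorProduct

noncomputable section

namespace WhiteNoise

/-! ### Growth functions and Legendre transforms -/

/-- The class `C_{+,1/2}`: positive continuous functions `u` on `[0, ∞)` such that
`log u(r) / √r → ∞` as `r → ∞`.  Values of `u` at negative reals are irrelevant. -/
structure IsCPlusHalf (u : ℝ → ℝ) : Prop where
  pos : ∀ r, 0 ≤ r → 0 < u r
  continuousOn : ContinuousOn u (Set.Ici 0)
  growth : Filter.Tendsto (fun r => Real.log (u r) / Real.sqrt r) Filter.atTop Filter.atTop

/-- The Legendre transform `ℓ_u(t) = inf_{r > 0} u(r) / r ^ t`. -/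
def legendre (u : ℝ → ℝ) (t : ℝ) : ℝ :=
  sInf ((fun r : ℝ => u r / r ^ t) '' Set.Ioi 0)

/-- The dual Legendre transform `u^*(r) = sup_{s ≥ 0} e^{2 √(r s)} / u(s)`.  The supremum is
over a nonempty set, which is bounded above when `u ∈ C_{+,1/2}`. -/
def dualLegendre (u : ℝ → ℝ) (r : ℝ) : ℝ :=
  sSup ((fun s : ℝ => Real.exp (2 * Real.sqrt (r * s)) / u s) '' Set.Ici 0)

/-! ### The nuclear space and its complexification

`H` is the real Hilbert space `𝓔₀`, and `A` is the positive self-adjoint operator in `H` that is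
diagonal in the orthonormal basis `e`, with `A e_j = lam j • e_j`.  Hence
`A ^ p f = ∑ j, lam j ^ p * ⟨e_j, f⟩ • e_j`. -/

section Space

variable {H : Type*} [NormedAddCommGroup H] [InnerProductSpace ℝ H]

/-- The space `𝓔 = ⋂_{p ≥ 0} 𝓔_p`, where `𝓔_p ⊆ H` is the domain of `A ^ p`: all `f` for which
the coefficients `lam j ^ p * ⟨e_j, f⟩` of `A ^ p f` are square summable. -/
def testSpace (e : HilbertBasis ℕ ℝ H) (lam : ℕ → ℝ) : Submodule ℝ H where
  carrier := {f | ∀ p : ℝ≥0, Memℓp (fun j => ((lam j ^ (p : ℝ) * e.repr f j : ℝ) : ℂ)) 2}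
  zero_mem' := fun p => by
    convert (zero_memℓp : Memℓp (0 : ℕ → ℂ) 2) using 1
    ext j
    simp
  add_mem' := fun {f g} hf hg p => by
    convert (hf p).add (hg p) using 1
    ext j
    simp [mul_add]
  smul_mem' := fun c f hf p => by
    convert (hf p).const_smul c using 1
    ext j
    simp
    ring

/-- The basis vectors `e_j` belong to `𝓔`. -/
theorem basis_mem_testSpace (e : HilbertBasis ℕ ℝ H) (lam : ℕ → ℝ) (j : ℕ) :
    e j ∈ testSpace e lam := by
  intro p
  refine memℓp_gen' (C := ‖lam j ^ (p : ℝ)‖ ^ 2) fun s => ?_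
  have h : ∀ i, ‖((lam i ^ (p : ℝ) * e.repr (e j) i : ℝ) : ℂ)‖ ^ (2 : ℝ≥0∞).toReal
      = if i = j then ‖lam j ^ (p : ℝ)‖ ^ 2 else 0 := by
    intro i
    rw [e.repr_self]
    by_cases hij : i = j
    · subst hij
      simp
    · simp [lp.single_apply, hij]
  simp_rw [h]
  rw [Finset.sum_ite_eq']
  split_ifs
  · exact le_rfl
  · positivity

/-- For `f ∈ 𝓔`, the vector `A ^ p f`, as the sequence of its coordinates in the basis `e`
(regarded as complex numbers). -/
def powReal (e : HilbertBasis ℕ ℝ H) (lam : ℕ → ℝ) (p : ℝ≥0) :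
    testSpace e lam →ₗ[ℝ] lp (fun _ : ℕ => ℂ) 2 where
  toFun f := ⟨fun j => ((lam j ^ (p : ℝ) * e.repr (f : H) j : ℝ) : ℂ), f.2 p⟩
  map_add' f g := by
    ext j
    simp only [Submodule.coe_add, map_add, lp.coeFn_add, Pi.add_apply, mul_add, Complex.ofReal_add]
  map_smul' c f := by
    ext j
    simp
    ring

/-- The complexification `𝓔_c = ℂ ⊗ 𝓔` of the real vector space `𝓔`. -/
def TestSpaceC (e : HilbertBasis ℕ ℝ H) (lam : ℕ → ℝ) : Type _ :=
  ℂ ⊗[ℝ] (testSpace e lam)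

instance (e : HilbertBasis ℕ ℝ H) (lam : ℕ → ℝ) : AddCommGroup (TestSpaceC e lam) :=
  inferInstanceAs (AddCommGroup (ℂ ⊗[ℝ] (testSpace e lam)))

instance (e : HilbertBasis ℕ ℝ H) (lam : ℕ → ℝ) : Module ℂ (TestSpaceC e lam) :=
  inferInstanceAs (Module ℂ (ℂ ⊗[ℝ] (testSpace e lam)))

/-- The basis vector `e_j` as an element of `𝓔_c`. -/
def basisC (e : HilbertBasis ℕ ℝ H) (lam : ℕ → ℝ) (j : ℕ) : TestSpaceC e lam :=
  (1 : ℂ) ⊗ₜ[ℝ] (⟨e j, basis_mem_testSpace e lam j⟩ : testSpace e lam)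

/-- The complex-linear extension of `A ^ p` to `𝓔_c`, in coordinates with respect to `e`. -/
def powC (e : HilbertBasis ℕ ℝ H) (lam : ℕ → ℝ) (p : ℝ≥0) :
    TestSpaceC e lam →ₗ[ℂ] lp (fun _ : ℕ => ℂ) 2 :=
  LinearMap.liftBaseChange ℂ (powReal e lam p)

/-- The norm `|ξ|_p = |A ^ p ξ|_0` on `𝓔_c`. -/
def normP (e : HilbertBasis ℕ ℝ H) (lam : ℕ → ℝ) : SeminormFamily ℂ (TestSpaceC e lam) ℝ≥0 :=
  fun p => (normSeminorm ℂ (lp (fun _ : ℕ => ℂ) 2)).comp (powC e lam p)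

/-- The projective limit topology of `𝓔_c`, generated by the norms `|·|_p`, `p ≥ 0`. -/
instance (e : HilbertBasis ℕ ℝ H) (lam : ℕ → ℝ) : TopologicalSpace (TestSpaceC e lam) :=
  (normP e lam).moduleFilterBasis.topology

theorem withSeminorms_normP (e : HilbertBasis ℕ ℝ H) (lam : ℕ → ℝ) :
    WithSeminorms (normP e lam) :=
  ⟨rfl⟩

/-- Entire functions on `𝓔_c × 𝓔_c`: continuous, and holomorphic on every complex line. -/
def IsEntire (e : HilbertBasis ℕ ℝ H) (lam : ℕ → ℝ)
    (F : TestSpaceC e lam × TestSpaceC e lam → ℂ) : Prop :=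
  Continuous F ∧ ∀ x y : TestSpaceC e lam × TestSpaceC e lam,
    Differentiable ℂ (fun z : ℂ => F (x + z • y))

/-- The inclusion `i_{q,p} : 𝓔_q → 𝓔_p` is Hilbert–Schmidt.  The vectors `lam j ^ (-q) • e_j`
form an orthonormal basis of `𝓔_q`, and `|lam j ^ (-q) • e_j|_p ^ 2 = lam j ^ (-2 * (q - p))`. -/
def InclusionIsHS (lam : ℕ → ℝ) (q p : ℝ) : Prop :=
  Summable fun j => lam j ^ (-2 * (q - p))

/-- The squared Hilbert–Schmidt norm of the inclusion `i_{q,p} : 𝓔_q → 𝓔_p`. -/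
def inclusionHSNormSq (lam : ℕ → ℝ) (q p : ℝ) : ℝ :=
  ∑' j, lam j ^ (-2 * (q - p))

/-! ### Kernels -/

/-- The dual of `𝓔_c^{⊗ (l+m)}`, described by the universal property of the (projective) tensor
product: continuous `(l+m)`-linear forms on `𝓔_c`, with `l` arguments in a first group and `m`
arguments in a second one. -/
abbrev Kernel (e : HilbertBasis ℕ ℝ H) (lam : ℕ → ℝ) (l m : ℕ) : Type _ :=
  ContinuousMultilinearMap ℂ (fun _ : Fin l ⊕ Fin m => TestSpaceC e lam) ℂ

/-- The kernel is symmetric in the first `l` and, separately, in the last `m` arguments. -/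
def Kernel.IsSymm {e : HilbertBasis ℕ ℝ H} {lam : ℕ → ℝ} {l m : ℕ}
    (κ : Kernel e lam l m) : Prop :=
  ∀ (σ : Equiv.Perm (Fin l)) (τ : Equiv.Perm (Fin m)) (x : Fin l ⊕ Fin m → TestSpaceC e lam),
    κ (x ∘ Sum.map σ τ) = κ x

/-- The pairing `⟨κ, ξ^{⊗ l} ⊗ η^{⊗ m}⟩`. -/
def Kernel.pair {e : HilbertBasis ℕ ℝ H} {lam : ℕ → ℝ} {l m : ℕ}
    (κ : Kernel e lam l m) (ξ η : TestSpaceC e lam) : ℂ :=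
  κ (Sum.elim (fun _ => ξ) (fun _ => η))

/-- The squared norm `|κ|²_{s₁,s₂} = |((A ^ s₁)^{⊗ l} ⊗ (A ^ s₂)^{⊗ m}) κ|₀²`, with values in
`[0, ∞]`: the sum of the squared absolute values of the coefficients of
`((A ^ s₁)^{⊗ l} ⊗ (A ^ s₂)^{⊗ m}) κ` with respect to the orthonormal basis
`e_{i₁} ⊗ ⋯ ⊗ e_{i_l} ⊗ e_{j₁} ⊗ ⋯ ⊗ e_{j_m}`. -/
def Kernel.normSq {e : HilbertBasis ℕ ℝ H} {lam : ℕ → ℝ} {l m : ℕ}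
    (κ : Kernel e lam l m) (s₁ s₂ : ℝ) : ℝ≥0∞ :=
  ∑' (i : Fin l → ℕ) (j : Fin m → ℕ), ENNReal.ofReal
    (((∏ a, lam (i a) ^ s₁) * (∏ b, lam (j b) ^ s₂) *
      ‖κ (Sum.elim (fun a => basisC e lam (i a)) (fun b => basisC e lam (j b)))‖) ^ 2)

end Space

end WhiteNoise

end

/-! ### Circle integrals with parameters -/

section CircleIntegral

open Metric Topology Filter

/-! The kernels are the Taylor coefficients of F at 0: `taylorKernel` is 1/(l! m!) times the mixed
directional derivative along l vectors (ξ_a, 0) and m vectors (0, η_b).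

The test space is not normed, so all calculus is done on complex lines by Cauchy integrals. These
show that a directional derivative of an entire function is again entire, is additive in the
direction, and commutes with the others. Mixed derivatives are therefore products in a commutative
algebra of operators, which makes the kernels multilinear and symmetric.

For the estimate, Cauchy's inequality is applied on a product of circles of radii R/|ξ_a| and
S/|η_b|. There the first argument of F has norm at most lR and the second at most mS. Putting r =
K₁(lR)², using l^l/l! ≤ e^l and taking the infimum over r produces (K₁e²)^l ℓ(l); the second group
is treated likewise (`le_mul_legendre`, `norm_taylorKernel_sq_le`). This bound makes the kernels
continuous. Evaluated on basis vectors, it factors over the slots, and each slot sums to a squared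
Hilbert–Schmidt norm (`Kernel.normSq_le`). -/

theorem continuous_parametric_circleIntegral {X : Type*} [TopologicalSpace X] {c : ℂ} {R : ℝ}
    (hR : 0 ≤ R) {F : X → ℂ → ℂ} (hF : Continuous fun p : X × sphere c R => F p.1 p.2) :
    Continuous fun x => ∮ z in C(c, R), F x z := by
  -- Currying turns joint continuity into continuity for the sup norm on the compact circle, hence
  -- uniform convergence of the integrands.
  let Φ : C(X, C(sphere c R, ℂ)) := ContinuousMap.curry ⟨fun p => F p.1 p.2, hF⟩
  have hslice : ∀ x, ContinuousOn (F x) (sphere c R) := fun x =>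
    continuousOn_iff_continuous_domRestrict.2 (hF.comp (by fun_prop : Continuous fun z => (x, z)))
  rw [continuous_iff_continuousAt]
  intro x₀
  have hΦ : Tendsto (fun x => Φ x) (𝓝 x₀) (𝓝 (Φ x₀)) := Φ.continuous.tendsto x₀
  rw [ContinuousMap.tendsto_iff_tendstoUniformly, Metric.tendstoUniformly_iff] at hΦ
  rw [ContinuousAt, Metric.tendsto_nhds]
  intro ε hε
  have hpos : 0 < 2 * Real.pi * R + 1 := by positivity
  filter_upwards [hΦ (ε / (2 * Real.pi * R + 1)) (by positivity)] with x hx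
  rw [dist_eq_norm, ← circleIntegral.integral_sub ((hslice x).circleIntegrable hR)
    ((hslice x₀).circleIntegrable hR)]
  refine lt_of_le_of_lt (circleIntegral.norm_integral_le_of_norm_le_const hR
    (C := ε / (2 * Real.pi * R + 1)) fun z hz => ?_) ?_
  · have := (hx ⟨z, hz⟩).le
    rwa [dist_comm, dist_eq_norm] at this
  · rw [mul_div_assoc', div_lt_iff₀ hpos]
    nlinarith

theorem circleIntegral_circleIntegral_swap {c d : ℂ} {R S : ℝ} (hR : 0 ≤ R) (hS : 0 ≤ S)
    {F : ℂ → ℂ → ℂ} (hF : ContinuousOn (fun p : ℂ × ℂ => F p.1 p.2) (sphere c R ×ˢ sphere d S)) :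
    (∮ z in C(c, R), ∮ w in C(d, S), F z w) = ∮ w in C(d, S), ∮ z in C(c, R), F z w := by
  have hcont : Continuous fun p : ℝ × ℝ =>
      deriv (circleMap c R) p.1 * (deriv (circleMap d S) p.2 *
        F (circleMap c R p.1) (circleMap d S p.2)) := by
    have h1 : Continuous fun p : ℝ × ℝ => F (circleMap c R p.1) (circleMap d S p.2) :=
      hF.comp_continuous (f := fun p : ℝ × ℝ => (circleMap c R p.1, circleMap d S p.2))
        (by fun_prop)
        fun p => ⟨circleMap_mem_sphere c hR _, circleMap_mem_sphere d hS _⟩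
    simp only [deriv_circleMap]
    exact (((continuous_circleMap 0 R).comp continuous_fst).mul continuous_const).mul
      ((((continuous_circleMap 0 S).comp continuous_snd).mul continuous_const).mul h1)
  simp only [circleIntegral, smul_eq_mul, ← intervalIntegral.integral_const_mul]
  rw [MeasureTheory.intervalIntegral_intervalIntegral_swap]
  · simp only [mul_left_comm]
  · refine (hcont.continuousOn.integrableOn_compact
      (K := Set.uIcc 0 (2 * Real.pi) ×ˢ Set.uIcc 0 (2 * Real.pi))
      (isCompact_uIcc.prod isCompact_uIcc)).mono_set ?_
    exact Set.prod_mono Set.uIoc_subset_uIcc Set.uIoc_subset_uIcc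

end CircleIntegral

/-! ### Entire functions on topological vector spaces -/

section Entire

open Metric Topology Filter

variable {E : Type*} [AddCommGroup E] [Module ℂ E] [TopologicalSpace E]

/-- A function is Gateaux entire if it is continuous, and holomorphic on every complex line. -/
def GateauxEntire (f : E → ℂ) : Prop :=
  Continuous f ∧ ∀ x y : E, Differentiable ℂ fun z : ℂ => f (x + z • y)

namespace GateauxEntire

variable {f : E → ℂ}

theorem hasDerivAt_line (hf : GateauxEntire f) (x v : E) (z : ℂ) :
    HasDerivAt (fun z : ℂ => f (x + z • v)) (lineDeriv ℂ f (x + z • v) v) z := by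
  have h : HasDerivAt (fun t : ℂ => f (x + z • v + t • v))
      (lineDeriv ℂ f (x + z • v) v) (z - z) := by
    rw [sub_self]
    exact (hf.2 (x + z • v) v 0).hasDerivAt
  have h2 := HasDerivAt.comp_sub_const z z h
  have e : (fun t : ℂ => f (x + t • v)) = fun t => f (x + z • v + (t - z) • v) := by
    ext t
    congr 1
    rw [sub_smul]
    abel
  rw [e]
  exact h2

/-- Writing the derivative as an integral over a compact circle lets continuity, holomorphy and
commutation of derivatives follow from continuity of `f` and Fubini. -/
theorem lineDeriv_eq_circleIntegral (hf : GateauxEntire f) (x v : E) :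
    lineDeriv ℂ f x v = (2 * Real.pi * Complex.I : ℂ)⁻¹ *
      ∮ z in C(0, 1), (z ^ 2)⁻¹ * f (x + z • v) := by
  have h := DifferentiableOn.deriv_eq_smul_circleIntegral (c := 0) one_pos
    (hf.2 x v).differentiableOn
  simp only [sub_zero, one_div, smul_eq_mul] at h
  rw [h, ← mul_assoc, inv_mul_cancel₀ Complex.two_pi_I_ne_zero, one_mul, lineDeriv]

theorem norm_lineDeriv_le (hf : GateauxEntire f) {x v : E} {R M : ℝ} (hR : 0 < R)
    (hM : ∀ z : ℂ, ‖z‖ = R → ‖f (x + z • v)‖ ≤ M) : ‖lineDeriv ℂ f x v‖ ≤ M / R :=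
  Complex.norm_deriv_le_of_forall_mem_sphere_norm_le hR (hf.2 x v).diffContOnCl
    fun z hz => hM z (by simpa using hz)

variable [ContinuousAdd E] [ContinuousSMul ℂ E]

theorem continuous_lineDeriv (hf : GateauxEntire f) (v : E) :
    Continuous fun x => lineDeriv ℂ f x v := by
  simp only [hf.lineDeriv_eq_circleIntegral]
  refine continuous_const.mul (continuous_parametric_circleIntegral zero_le_one ?_)
  refine Continuous.mul (Continuous.inv₀ (by fun_prop) fun p => ?_) (hf.1.comp (by fun_prop))
  exact pow_ne_zero 2 (ne_zero_of_mem_unit_sphere p.2)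

theorem lineDeriv_right (hf : GateauxEntire f) (v : E) :
    GateauxEntire fun x => lineDeriv ℂ f x v := by
  refine ⟨hf.continuous_lineDeriv v, fun x y z => ?_⟩
  obtain ⟨R, hR⟩ := exists_gt ‖z‖
  have hR0 : 0 < R := (norm_nonneg z).trans_lt hR
  let G : ℂ → ℂ := fun z => lineDeriv ℂ f (x + z • y) v
  have hG : Continuous G := (hf.continuous_lineDeriv v).comp (by fun_prop)
  -- `G` reproduces itself under the Cauchy integral: apply Cauchy's formula in the direction `y`
  -- under the integral defining the derivative along `v`, then swap the two circles.
  have key : ∀ w ∈ ball (0 : ℂ) R,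
      G w = (2 * Real.pi * Complex.I : ℂ)⁻¹ • ∮ ζ in C(0, R), (ζ - w)⁻¹ • G ζ := by
    intro w hw
    have h1 : ∀ t : ℂ, f (x + w • y + t • v) = (2 * Real.pi * Complex.I : ℂ)⁻¹ *
        ∮ ζ in C(0, R), (ζ - w)⁻¹ * f (x + ζ • y + t • v) := by
      intro t
      have h := DifferentiableOn.circleIntegral_sub_inv_smul (c := 0)
        (hf.2 (x + t • v) y).differentiableOn hw
      simp only [smul_eq_mul] at h
      simp only [add_right_comm x _ (t • v), h, ← mul_assoc,
        inv_mul_cancel₀ Complex.two_pi_I_ne_zero, one_mul]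
    simp only [G, hf.lineDeriv_eq_circleIntegral, h1, smul_eq_mul]
    simp only [← circleIntegral.integral_const_mul]
    rw [circleIntegral_circleIntegral_swap zero_le_one hR0.le]
    · refine circleIntegral.integral_congr hR0.le fun ζ _ => ?_
      refine circleIntegral.integral_congr zero_le_one fun t _ => ?_
      ring
    · refine continuousOn_const.mul (ContinuousOn.mul ?_ (continuousOn_const.mul
        (ContinuousOn.mul ?_ (hf.1.comp (by fun_prop)).continuousOn)))
      · exact ContinuousOn.inv₀ (by fun_prop) fun p hp =>
          pow_ne_zero 2 (ne_zero_of_mem_unit_sphere ⟨_, hp.1⟩)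
      · refine ContinuousOn.inv₀ (by fun_prop) fun p hp => sub_ne_zero.2 ?_
        rintro rfl
        have h1 := hp.2
        rw [mem_sphere] at h1
        exact absurd (mem_ball.1 hw) (by rw [h1]; exact lt_irrefl _)
  have hz : z ∈ ball (0 : ℂ) R := by simpa using hR
  lift R to ℝ≥0 using hR0.le
  -- The Cauchy integral of a merely continuous function is analytic inside the circle.
  have h2 := (hasFPowerSeriesOn_cauchy_integral (f := G) (c := 0)
    (hG.continuousOn.circleIntegrable R.2) (by exact_mod_cast hR0)).differentiableOn
  have h3 : DifferentiableOn ℂ G (ball 0 R) := by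
    rw [Metric.eball_coe] at h2
    exact h2.congr key
  exact h3.differentiableAt (isOpen_ball.mem_nhds hz)

/-- Both sides are the same double circle integral, taken in opposite orders. -/
theorem lineDeriv_comm (hf : GateauxEntire f) (x v w : E) :
    lineDeriv ℂ (fun y => lineDeriv ℂ f y v) x w = lineDeriv ℂ (fun y => lineDeriv ℂ f y w) x v := by
  rw [(hf.lineDeriv_right v).lineDeriv_eq_circleIntegral,
    (hf.lineDeriv_right w).lineDeriv_eq_circleIntegral]
  simp only [hf.lineDeriv_eq_circleIntegral]
  congr 1
  simp only [← circleIntegral.integral_const_mul]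
  rw [circleIntegral_circleIntegral_swap zero_le_one zero_le_one]
  · refine circleIntegral.integral_congr zero_le_one fun ζ _ => ?_
    refine circleIntegral.integral_congr zero_le_one fun t _ => ?_
    simp only [add_right_comm x (t • w)]
    ring
  · refine ContinuousOn.mul ?_ (continuousOn_const.mul
      (ContinuousOn.mul ?_ (hf.1.comp (by fun_prop)).continuousOn))
    · exact ContinuousOn.inv₀ (by fun_prop) fun p hp =>
        pow_ne_zero 2 (ne_zero_of_mem_unit_sphere ⟨_, hp.1⟩)
    · exact ContinuousOn.inv₀ (by fun_prop) fun p hp =>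
        pow_ne_zero 2 (ne_zero_of_mem_unit_sphere ⟨_, hp.2⟩)

/-- The function f(x + sv + tw) of two complex variables has continuous partial derivatives, so it
is jointly differentiable; the chain rule along the diagonal s = t gives the sum. -/
theorem lineDeriv_add_right (hf : GateauxEntire f) (x v w : E) :
    lineDeriv ℂ f x (v + w) = lineDeriv ℂ f x v + lineDeriv ℂ f x w := by
  let g : ℂ → ℂ → ℂ := fun s t => f (x + s • v + t • w)
  let g₁ : ℂ → ℂ → ℂ →L[ℂ] ℂ := fun s t =>
    ContinuousLinearMap.toSpanSingleton ℂ (lineDeriv ℂ f (x + s • v + t • w) v)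
  let g₂ : ℂ → ℂ → ℂ →L[ℂ] ℂ := fun s t =>
    ContinuousLinearMap.toSpanSingleton ℂ (lineDeriv ℂ f (x + s • v + t • w) w)
  have hg₁ : ∀ p : ℂ × ℂ, HasFDerivAt (g · p.2) (g₁ p.1 p.2) p.1 := fun p => by
    have h := (hf.hasDerivAt_line (x + p.2 • w) v p.1).hasFDerivAt
    simp only [add_right_comm x (p.2 • w)] at h
    exact h
  have hg₂ : ∀ p : ℂ × ℂ, HasFDerivAt (g p.1 ·) (g₂ p.1 p.2) p.2 := fun p =>
    (hf.hasDerivAt_line (x + p.1 • v) w p.2).hasFDerivAt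
  have hc : ∀ u : E, Continuous fun p : ℂ × ℂ =>
      ContinuousLinearMap.toSpanSingleton ℂ (lineDeriv ℂ f (x + p.1 • v + p.2 • w) u) := fun u =>
    (ContinuousLinearMap.toSpanSingletonCLE (𝕜 := ℂ) (E := ℂ)).continuous.comp
      ((hf.continuous_lineDeriv u).comp (by fun_prop))
  have h := (hasStrictFDerivAt_uncurry_coprod (u := ((0 : ℂ), (0 : ℂ))) (f := g) (f₁ := g₁)
    (f₂ := g₂) (Eventually.of_forall hg₁) (Eventually.of_forall hg₂) (hc v).continuousAt
    (hc w).continuousAt).hasFDerivAt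
  have h2 := HasFDerivAt.comp_hasDerivAt (0 : ℂ) (f := fun t : ℂ => (t, t)) h
    ((hasDerivAt_id (0 : ℂ)).prodMk (hasDerivAt_id 0))
  have h3 := h2.deriv
  simp only [Function.comp_def, Function.HasUncurry.uncurry, id, g, g₁, g₂] at h3
  simp only [lineDeriv]
  simp only [smul_add, ← add_assoc]
  rw [h3]
  simp [lineDeriv]

end GateauxEntire

end Entire

/-! ### The commutative algebra of directional derivatives -/

section DerivAlgebra

open scoped IsMulCommutative
open Metric Topology Filter

variable (E : Type*) [AddCommGroup E] [Module ℂ E] [TopologicalSpace E]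

/-- The space of Gateaux entire functions. -/
def entireSubmodule : Submodule ℂ (E → ℂ) where
  carrier := {f | GateauxEntire f}
  zero_mem' := ⟨continuous_const, fun _ _ => differentiable_const 0⟩
  add_mem' hf hg := ⟨hf.1.add hg.1, fun x y => (hf.2 x y).add (hg.2 x y)⟩
  smul_mem' c _ hf := ⟨hf.1.const_smul c, fun x y => (hf.2 x y).const_smul c⟩

variable [ContinuousAdd E] [ContinuousSMul ℂ E]

/-- Directional derivatives, as commuting endomorphisms of the space of entire functions which
depend linearly on the direction. -/
noncomputable def dirDeriv : E →ₗ[ℂ] Module.End ℂ (entireSubmodule E) where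
  toFun v :=
    { toFun := fun f => ⟨fun x => lineDeriv ℂ (f : E → ℂ) x v, f.2.lineDeriv_right v⟩
      map_add' := fun f g => by
        ext x
        exact deriv_add (f.2.2 x v 0) (g.2.2 x v 0)
      map_smul' := fun c f => by
        ext x
        exact deriv_const_smul c (f.2.2 x v 0) }
  map_add' v w := by
    ext f x
    exact f.2.lineDeriv_add_right x v w
  map_smul' c v := by
    ext f x
    exact lineDeriv_smul

variable {E}

@[simp]
theorem dirDeriv_apply (v : E) (f : entireSubmodule E) (x : E) :
    (dirDeriv E v f : E → ℂ) x = lineDeriv ℂ (f : E → ℂ) x v := rfl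

theorem dirDeriv_mul_comm (v w : E) : dirDeriv E v * dirDeriv E w = dirDeriv E w * dirDeriv E v := by
  ext f x
  exact f.2.lineDeriv_comm x w v

variable (E) in
/-- The commutative algebra generated by the directional derivatives. -/
noncomputable abbrev derivAlgebra : Subalgebra ℂ (Module.End ℂ (entireSubmodule E)) :=
  Algebra.adjoin ℂ (Set.range (dirDeriv E))

/-- Products over an unordered finite index type now make sense, and symmetry of mixed derivatives
becomes reindexing of a product. -/
instance : IsMulCommutative (derivAlgebra E) :=
  Algebra.isMulCommutative_adjoin ℂ (by
    rintro _ ⟨v, rfl⟩ _ ⟨w, rfl⟩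
    exact dirDeriv_mul_comm v w)

variable (E) in
/-- Directional derivatives as elements of the commutative algebra they generate. -/
noncomputable def derivElem : E →ₗ[ℂ] derivAlgebra E :=
  (dirDeriv E).codRestrict (Subalgebra.toSubmodule (derivAlgebra E))
    fun v => Algebra.subset_adjoin ⟨v, rfl⟩

/-- Evaluation at `0` of the result of a differential operator. -/
def derivEval (f : entireSubmodule E) : derivAlgebra E →ₗ[ℂ] ℂ where
  toFun T := ((T : Module.End ℂ (entireSubmodule E)) f : E → ℂ) 0
  map_add' _ _ := rfl
  map_smul' _ _ := rfl

/-- The mixed derivatives at `0` of an entire function, as a multilinear form. -/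
noncomputable def mixedDeriv (ι : Type*) [Fintype ι] (f : entireSubmodule E) :
    MultilinearMap ℂ (fun _ : ι => E) ℂ :=
  ((derivEval f).compMultilinearMap (MultilinearMap.mkPiAlgebra ℂ ι (derivAlgebra E))).compLinearMap
    fun _ => derivElem E

theorem mixedDeriv_apply {ι : Type*} [Fintype ι] (f : entireSubmodule E) (v : ι → E) :
    mixedDeriv ι f v = derivEval f (∏ i, derivElem E (v i)) := rfl

theorem mixedDeriv_comp_equiv {ι : Type*} [Fintype ι] (f : entireSubmodule E) (v : ι → E)
    (σ : Equiv.Perm ι) : mixedDeriv ι f (v ∘ σ) = mixedDeriv ι f v := by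
  rw [mixedDeriv_apply, mixedDeriv_apply]
  congr 1
  exact Equiv.prod_comp σ fun i => derivElem E (v i)

/-- Iterated one-variable Cauchy estimates: one direction is peeled off on its circle, and the
induction hypothesis is used at the shifted base point, which is why `x` is generalized. -/
theorem norm_prod_derivElem_apply_le {ι : Type*} (s : Finset ι) (f : entireSubmodule E) (v : ι → E)
    {R : ι → ℝ} (hR : ∀ i, 0 < R i) {M : ℝ} (x : E)
    (hM : ∀ z : ι → ℂ, (∀ i, ‖z i‖ = R i) → ‖(f : E → ℂ) (x + ∑ i ∈ s, z i • v i)‖ ≤ M) :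
    ‖(((∏ i ∈ s, derivElem E (v i) : derivAlgebra E) : Module.End ℂ (entireSubmodule E)) f
      : E → ℂ) x‖ ≤ M / ∏ i ∈ s, R i := by
  classical
  induction s using Finset.induction_on generalizing x with
  | empty =>
    have h := hM (fun i => (R i : ℂ)) fun i => by simp [abs_of_pos (hR i)]
    simpa using h
  | insert a s ha ih =>
    rw [Finset.prod_insert ha, Finset.prod_insert ha, mul_comm (R a), ← div_div]
    refine GateauxEntire.norm_lineDeriv_le (Subtype.property _) (hR a) fun z hz => ?_
    refine ih (x + z • v a) fun w hw => ?_
    have h := hM (Function.update w a z) fun i => by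
      by_cases hi : i = a
      · subst hi
        simpa using hz
      · simpa [hi] using hw i
    rw [Finset.sum_insert ha, Function.update_self, ← add_assoc] at h
    convert h using 5 with i hi
    rw [Function.update_of_ne (ne_of_mem_of_not_mem hi ha)]

theorem norm_mixedDeriv_le {ι : Type*} [Fintype ι] (f : entireSubmodule E) (v : ι → E)
    {R : ι → ℝ} (hR : ∀ i, 0 < R i) {M : ℝ}
    (hM : ∀ z : ι → ℂ, (∀ i, ‖z i‖ = R i) → ‖(f : E → ℂ) (∑ i, z i • v i)‖ ≤ M) :
    ‖mixedDeriv ι f v‖ ≤ M / ∏ i, R i :=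
  norm_prod_derivElem_apply_le Finset.univ f v hR 0 (by simpa using hM)

theorem iteratedDeriv_line (f : entireSubmodule E) (x v : E) (n : ℕ) :
    iteratedDeriv n (fun z : ℂ => (f : E → ℂ) (x + z • v)) =
      fun z : ℂ => ((dirDeriv E v ^ n) f : E → ℂ) (x + z • v) := by
  induction n with
  | zero => simp
  | succ n ih =>
    rw [iteratedDeriv_succ, ih]
    ext z
    rw [pow_succ']
    exact (GateauxEntire.hasDerivAt_line (Subtype.property _) x v z).deriv

theorem hasSum_taylor_dirDeriv (f : entireSubmodule E) (x v : E) :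
    HasSum (fun n : ℕ => (n.factorial : ℂ)⁻¹ * ((dirDeriv E v ^ n) f : E → ℂ) x)
      ((f : E → ℂ) (x + v)) := by
  have h := Complex.hasSum_taylorSeries_of_entire (f.2.2 x v) 0 1
  simp only [iteratedDeriv_line] at h
  simpa using h

theorem norm_dirDeriv_pow_le (f : entireSubmodule E) (x v : E) (n : ℕ) {R M : ℝ} (hR : 0 < R)
    (hM : ∀ z : ℂ, ‖z‖ = R → ‖(f : E → ℂ) (x + z • v)‖ ≤ M) :
    ‖((dirDeriv E v ^ n) f : E → ℂ) x‖ ≤ n.factorial * M / R ^ n := by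
  have h := Complex.norm_iteratedDeriv_le_of_forall_mem_sphere_norm_le n hR
    (f.2.2 x v).diffContOnCl (c := 0) (C := M) fun z hz => hM z (by simpa using hz)
  simpa [iteratedDeriv_line] using h

/-- The double Taylor series of an entire function converges unconditionally. -/
theorem hasSum_double_taylor_dirDeriv (f : entireSubmodule E) (v w : E) :
    HasSum (fun n : ℕ × ℕ => ((n.1.factorial : ℂ)⁻¹ * (n.2.factorial : ℂ)⁻¹) *
      ((dirDeriv E v ^ n.1) ((dirDeriv E w ^ n.2) f) : E → ℂ) 0) ((f : E → ℂ) (v + w)) := by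
  -- Radius 2 exceeds the evaluation point 1, so Cauchy's estimates bound the coefficients by the
  -- geometric terms M 2^(-l-m).
  obtain ⟨M, hM⟩ : ∃ M, ∀ p ∈ closedBall (0 : ℂ) 2 ×ˢ closedBall (0 : ℂ) 2,
      ‖(f : E → ℂ) (p.1 • v + p.2 • w)‖ ≤ M :=
    ((isCompact_closedBall _ _).prod (isCompact_closedBall _ _)).exists_bound_of_continuousOn
      (f.2.1.comp (by fun_prop)).continuousOn
  have hbound : ∀ n : ℕ × ℕ, ‖((n.1.factorial : ℂ)⁻¹ * (n.2.factorial : ℂ)⁻¹) *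
      ((dirDeriv E v ^ n.1) ((dirDeriv E w ^ n.2) f) : E → ℂ) 0‖
        ≤ M * ((1 / 2) ^ n.1 * (1 / 2) ^ n.2) := by
    rintro ⟨l, m⟩
    have h := norm_dirDeriv_pow_le ((dirDeriv E w ^ m) f) 0 v l two_pos fun z hz =>
      norm_dirDeriv_pow_le f (0 + z • v) w m two_pos fun t ht => by
        rw [zero_add]
        exact hM (z, t) ⟨by simp [hz], by simp [ht]⟩
    have hl : (0 : ℝ) < l.factorial := by positivity
    have hm : (0 : ℝ) < m.factorial := by positivity
    rw [norm_mul, norm_mul, norm_inv, norm_inv, Complex.norm_natCast, Complex.norm_natCast]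
    refine (mul_le_mul_of_nonneg_left h (by positivity)).trans (le_of_eq ?_)
    rw [one_div, inv_pow, inv_pow]
    field_simp
  have hgeom : Summable fun n : ℕ => ((1 : ℝ) / 2) ^ n := summable_geometric_two
  have hsum := Summable.of_norm_bounded
    ((hgeom.mul_of_nonneg hgeom (fun _ => by positivity) fun _ => by positivity).mul_left M) hbound
  -- For fixed `m`, summing over `l` moves the base point of the derivative from 0 to `v`; the sum
  -- over `m` is then the Taylor series at `v` in the direction `w`.
  have hcol : ∀ m : ℕ, HasSum (fun l : ℕ => ((l.factorial : ℂ)⁻¹ * (m.factorial : ℂ)⁻¹) *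
      ((dirDeriv E v ^ l) ((dirDeriv E w ^ m) f) : E → ℂ) 0)
      ((m.factorial : ℂ)⁻¹ * ((dirDeriv E w ^ m) f : E → ℂ) v) := fun m => by
    have h := (hasSum_taylor_dirDeriv ((dirDeriv E w ^ m) f) 0 v).mul_left (m.factorial : ℂ)⁻¹
    rw [zero_add] at h
    rw [show (fun l : ℕ => _) = _ from funext fun l => by rw [mul_comm (l.factorial : ℂ)⁻¹, mul_assoc]]
    exact h
  have h := ((Equiv.prodComm ℕ ℕ).hasSum_iff.2 hsum.hasSum).prod_fiberwise hcol
  rw [(hasSum_taylor_dirDeriv f v w).unique h]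
  exact hsum.hasSum

end DerivAlgebra

/-! ### Dual Legendre transforms -/

namespace WhiteNoise

/-- Far out, the growth condition gives 2√r√s ≤ log u(s), so the quotient is at most 1; the
remaining interval is compact. -/
theorem IsCPlusHalf.bddAbove_dualLegendre {u : ℝ → ℝ} (hu : IsCPlusHalf u) {r : ℝ} (hr : 0 ≤ r) :
    BddAbove ((fun s : ℝ => Real.exp (2 * Real.sqrt (r * s)) / u s) '' Set.Ici 0) := by
  obtain ⟨S, hS⟩ := Filter.eventually_atTop.1
    ((hu.growth.eventually_ge_atTop (2 * Real.sqrt r)).and (Filter.eventually_gt_atTop 0))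
  have hcont : ContinuousOn (fun s : ℝ => Real.exp (2 * Real.sqrt (r * s)) / u s)
      (Set.Icc 0 S) :=
    ContinuousOn.div (by fun_prop) (hu.continuousOn.mono fun s hs => hs.1)
      fun s hs => (hu.pos s hs.1).ne'
  obtain ⟨B, hB⟩ := isCompact_Icc.bddAbove_image hcont
  refine ⟨max B 1, ?_⟩
  rintro _ ⟨s, hs, rfl⟩
  rcases le_total s S with h | h
  · exact le_max_of_le_left (hB ⟨s, ⟨hs, h⟩, rfl⟩)
  · obtain ⟨h1, h2⟩ := hS s h
    have hus := hu.pos s hs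
    refine le_max_of_le_right ((div_le_one hus).2 ?_)
    rw [← Real.le_log_iff_exp_le hus, Real.sqrt_mul hr, ← mul_assoc]
    exact (le_div_iff₀ (Real.sqrt_pos.2 h2)).1 h1

theorem IsCPlusHalf.dualLegendre_pos {u : ℝ → ℝ} (hu : IsCPlusHalf u) {r : ℝ} (hr : 0 ≤ r) :
    0 < dualLegendre u r :=
  (div_pos (Real.exp_pos _) (hu.pos 0 le_rfl)).trans_le
    (le_csSup (hu.bddAbove_dualLegendre hr) ⟨0, Set.self_mem_Ici, rfl⟩)

theorem IsCPlusHalf.dualLegendre_monotoneOn {u : ℝ → ℝ} (hu : IsCPlusHalf u) :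
    MonotoneOn (dualLegendre u) (Set.Ici 0) := by
  intro r _ t ht hrt
  refine csSup_le (Set.nonempty_Ici.image _) ?_
  rintro _ ⟨s, hs, rfl⟩
  refine le_trans ?_ (le_csSup (hu.bddAbove_dualLegendre ht) ⟨s, hs, rfl⟩)
  have hus := hu.pos s hs
  have hs' : 0 ≤ s := hs
  dsimp only
  gcongr

/-- Optimizing Cauchy estimates over the radius leads to the Legendre transform. -/
theorem le_mul_legendre {u : ℝ → ℝ} (hu : MonotoneOn u (Set.Ici 0)) (hu0 : ∀ r, 0 ≤ r → 0 ≤ u r)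
    {K c X : ℝ} (hK : 0 ≤ K) (hc : 0 ≤ c) (l : ℕ)
    (h : ∀ R : ℝ, 0 < R → X ≤ c * (u (K * (l * R) ^ 2) / (l.factorial * R ^ l) ^ 2)) :
    X ≤ c * ((K * Real.exp 1 ^ 2) ^ l * legendre u l) := by
  have hne : ((fun r : ℝ => u r / r ^ (l : ℝ)) '' Set.Ioi 0).Nonempty := Set.nonempty_Ioi.image _
  have hleg : ∀ {d : ℝ}, 0 ≤ d → (∀ r : ℝ, 0 < r → X ≤ d * (u r / r ^ l)) →
      X ≤ d * legendre u l := by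
    intro d hd H
    rcases hd.eq_or_lt with rfl | hd
    · simpa using H 1 one_pos
    · rw [← div_le_iff₀' hd]
      refine le_csInf hne ?_
      rintro _ ⟨r, hr, rfl⟩
      dsimp only
      rw [div_le_iff₀' hd, Real.rpow_natCast]
      exact H r hr
  rw [← mul_assoc]
  refine hleg (by positivity) fun r hr => ?_
  rcases Nat.eq_zero_or_pos l with rfl | hl
  · have h1 := h 1 one_pos
    simp only [CharP.cast_eq_zero, ne_eq, OfNat.ofNat_ne_zero, not_false_eq_true,
      zero_pow, mul_zero, Nat.factorial_zero, Nat.cast_one, pow_zero, mul_one, one_pow,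
      div_one] at h1 ⊢
    exact h1.trans (mul_le_mul_of_nonneg_left (hu Set.self_mem_Ici hr.le hr.le) hc)
  -- For K = 0 and l > 0 the claimed bound is 0, reached by letting R tend to infinity.
  rcases hK.eq_or_lt with rfl | hK
  · simp only [zero_mul, zero_pow hl.ne', mul_zero]
    have hlim : Filter.Tendsto (fun R : ℝ => c * (u 0 / (l.factorial * R ^ l) ^ 2)) Filter.atTop
        (nhds (c * 0)) := by
      refine Filter.Tendsto.const_mul _ (Filter.Tendsto.const_div_atTop ?_ _)
      refine (Filter.tendsto_pow_atTop two_ne_zero).comp ?_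
      exact (Filter.tendsto_pow_atTop hl.ne').const_mul_atTop (by positivity)
    rw [mul_zero] at hlim
    refine ge_of_tendsto hlim ?_
    filter_upwards [Filter.eventually_gt_atTop 0] with R hR
    simpa using h R hR
  · have hl' : (0 : ℝ) < l := by exact_mod_cast hl
    -- This radius solves K(lR)² = r.
    have hR : 0 < Real.sqrt (r / K) / l := by positivity
    have h1 := h _ hR
    rw [mul_div_cancel₀ _ hl'.ne', Real.sq_sqrt (by positivity), mul_div_cancel₀ _ hK.ne'] at h1
    refine h1.trans ?_
    have hfac : (l : ℝ) ^ l / l.factorial ≤ Real.exp 1 ^ l := by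
      rw [← Real.exp_nat_mul, mul_one]
      exact Real.pow_div_factorial_le_exp _ hl'.le l
    have hden : (l.factorial * (Real.sqrt (r / K) / l) ^ l) ^ 2 =
        r ^ l / (K ^ l * ((l : ℝ) ^ l / l.factorial) ^ 2) := by
      have : (Real.sqrt (r / K) ^ l) ^ 2 = r ^ l / K ^ l := by
        rw [← pow_mul, mul_comm, pow_mul, Real.sq_sqrt (by positivity), div_pow]
      rw [mul_pow, div_pow, div_pow, this]
      field_simp
    rw [hden, div_div_eq_mul_div, mul_div_right_comm, mul_comm (u r / r ^ l), ← mul_assoc]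
    refine mul_le_mul_of_nonneg_right ?_ (div_nonneg (hu0 r hr.le) (by positivity))
    rw [mul_pow, ← pow_mul, mul_comm 2 l, pow_mul]
    gcongr

end WhiteNoise

/-! ### Sums over multi-indices -/

theorem ENNReal.tsum_prod_fin (g : ℕ → ℝ≥0∞) (l : ℕ) :
    ∑' i : Fin l → ℕ, ∏ a, g (i a) = (∑' j, g j) ^ l := by
  induction l with
  | zero => simp
  | succ l ih =>
    rw [← (Fin.consEquiv fun _ : Fin (l + 1) => ℕ).tsum_eq, ENNReal.tsum_prod', pow_succ', ← ih,
      ← ENNReal.tsum_mul_right]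
    refine tsum_congr fun j => ?_
    rw [← ENNReal.tsum_mul_left]
    refine tsum_congr fun i => ?_
    simp [Fin.prod_univ_succ, Fin.consEquiv]

/-! ### Continuity of multilinear forms bounded by seminorms -/

section SeminormBound

variable {E : Type*} [AddCommGroup E] [Module ℂ E]

/-- A vector space regarded as a seminormed space by means of a given seminorm. -/
def WithSeminorm (_ : Seminorm ℂ E) : Type _ := E

instance (p : Seminorm ℂ E) : SeminormedAddCommGroup (WithSeminorm p) :=
  p.toAddGroupSeminorm.toSeminormedAddCommGroup

instance (p : Seminorm ℂ E) : NormedSpace ℂ (WithSeminorm p) where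
  toModule := inferInstanceAs (Module ℂ E)
  norm_smul_le c x := (map_smul_eq_mul p c x).le

/-- The identity map onto the seminormed space `WithSeminorm p`. -/
def toWithSeminorm (p : Seminorm ℂ E) : E ≃ₗ[ℂ] WithSeminorm p := LinearEquiv.refl ℂ E

theorem norm_toWithSeminorm (p : Seminorm ℂ E) (x : E) : ‖toWithSeminorm p x‖ = p x := rfl

theorem continuous_toWithSeminorm [TopologicalSpace E] [IsTopologicalAddGroup E]
    {p : Seminorm ℂ E} (hp : Continuous p) : Continuous (toWithSeminorm p) := by
  rw [continuous_iff_continuousAt]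
  intro x₀
  rw [ContinuousAt, tendsto_iff_norm_sub_tendsto_zero]
  simp only [← map_sub, norm_toWithSeminorm]
  have h : Continuous fun x : E => p (x - x₀) := hp.comp (by fun_prop)
  simpa using h.tendsto x₀

/-- Give each slot the seminormed structure of its own seminorm: boundedness yields continuity
there, and the identity into these spaces is continuous. -/
theorem MultilinearMap.continuous_of_seminorm_bound [TopologicalSpace E] [IsTopologicalAddGroup E]
    {ι : Type*} [Fintype ι] (f : MultilinearMap ℂ (fun _ : ι => E) ℂ) (p : ι → Seminorm ℂ E)
    (hp : ∀ i, Continuous (p i)) (B : ℝ) (hB : ∀ x, ‖f x‖ ≤ B * ∏ i, p i (x i)) :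
    Continuous f := by
  have hg : Continuous (f.compLinearMap fun i => (toWithSeminorm (p i)).symm.toLinearMap) :=
    MultilinearMap.continuous_of_bound _ B fun x => hB fun i => (toWithSeminorm (p i)).symm (x i)
  have hid : Continuous fun (x : ι → E) (i : ι) => toWithSeminorm (p i) (x i) :=
    continuous_pi fun i => (continuous_toWithSeminorm (hp i)).comp (continuous_apply i)
  exact hg.comp hid

end SeminormBound

/-! ### Taylor kernels -/

section TaylorKernel

open Topology Filter
open scoped IsMulCommutative

variable {E : Type*} [AddCommGroup E] [Module ℂ E] [TopologicalSpace E] [ContinuousAdd E]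
  [ContinuousSMul ℂ E]

variable (E) in
/-- The embedding of the `i`-th argument into `E × E`. -/
def slotEmbedding {l m : ℕ} : Fin l ⊕ Fin m → E →ₗ[ℂ] E × E :=
  Sum.elim (fun _ => LinearMap.inl ℂ E E) (fun _ => LinearMap.inr ℂ E E)

/-- The kernel of bidegree `(l, m)` in the Taylor expansion of an entire function at `0`. -/
noncomputable def taylorKernel (f : entireSubmodule (E × E)) (l m : ℕ) :
    MultilinearMap ℂ (fun _ : Fin l ⊕ Fin m => E) ℂ :=
  ((l.factorial : ℂ)⁻¹ * (m.factorial : ℂ)⁻¹) •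
    (mixedDeriv (Fin l ⊕ Fin m) f).compLinearMap (slotEmbedding E)

theorem taylorKernel_apply (f : entireSubmodule (E × E)) (l m : ℕ) (x : Fin l ⊕ Fin m → E) :
    taylorKernel f l m x = ((l.factorial : ℂ)⁻¹ * (m.factorial : ℂ)⁻¹) *
      mixedDeriv (Fin l ⊕ Fin m) f fun i => slotEmbedding E i (x i) := rfl

theorem taylorKernel_comp_sumMap (f : entireSubmodule (E × E)) {l m : ℕ} (σ : Equiv.Perm (Fin l))
    (τ : Equiv.Perm (Fin m)) (x : Fin l ⊕ Fin m → E) :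
    taylorKernel f l m (x ∘ Sum.map σ τ) = taylorKernel f l m x := by
  rw [taylorKernel_apply, taylorKernel_apply,
    ← mixedDeriv_comp_equiv f (fun i => slotEmbedding E i (x i)) (Equiv.sumCongr σ τ)]
  congr 2
  ext1 i
  cases i <;> rfl

theorem hasSum_taylorKernel (f : entireSubmodule (E × E)) (ξ η : E) :
    HasSum (fun n : ℕ × ℕ => taylorKernel f n.1 n.2 (Sum.elim (fun _ => ξ) fun _ => η))
      ((f : E × E → ℂ) (ξ, η)) := by
  have h := hasSum_double_taylor_dirDeriv f (ξ, 0) (0, η)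
  rw [Prod.mk_add_mk, add_zero, zero_add] at h
  convert h using 2 with n
  rw [taylorKernel_apply, mixedDeriv_apply, Fintype.prod_sum_type]
  simp only [slotEmbedding, Sum.elim_inl, Sum.elim_inr, Finset.prod_const, Finset.card_univ,
    Fintype.card_fin]
  rfl

/-- Slot `a` runs over a circle of radius R/ρ_a, so each of the `l` summands has seminorm at most R.
Positive majorants ρ, σ replace the seminorms, which may vanish and cannot be divided by. -/
theorem norm_taylorKernel_sq_le_of_radii {f : entireSubmodule (E × E)} {N₁ N₂ : Seminorm ℂ E}
    {w₁ w₂ : ℝ → ℝ} (hw₁ : MonotoneOn w₁ (Set.Ici 0)) (hw₂ : MonotoneOn w₂ (Set.Ici 0))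
    (hw₁0 : ∀ r, 0 ≤ r → 0 ≤ w₁ r) (hw₂0 : ∀ r, 0 ≤ r → 0 ≤ w₂ r)
    {C K₁ K₂ : ℝ} (hC : 0 ≤ C) (hK₁ : 0 ≤ K₁) (hK₂ : 0 ≤ K₂)
    (hf : ∀ ξ η, ‖(f : E × E → ℂ) (ξ, η)‖ ^ 2 ≤ C * w₁ (K₁ * N₁ ξ ^ 2) * w₂ (K₂ * N₂ η ^ 2))
    {l m : ℕ} (x : Fin l ⊕ Fin m → E) {ρ : Fin l → ℝ} {σ : Fin m → ℝ}
    (hρ0 : ∀ a, 0 < ρ a) (hσ0 : ∀ b, 0 < σ b) (hρ : ∀ a, N₁ (x (Sum.inl a)) ≤ ρ a)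
    (hσ : ∀ b, N₂ (x (Sum.inr b)) ≤ σ b) {R S : ℝ} (hR : 0 < R) (hS : 0 < S) :
    ‖taylorKernel f l m x‖ ^ 2 ≤ C * (∏ a, ρ a) ^ 2 * (∏ b, σ b) ^ 2 *
      (w₁ (K₁ * (l * R) ^ 2) / (l.factorial * R ^ l) ^ 2) *
      (w₂ (K₂ * (m * S) ^ 2) / (m.factorial * S ^ m) ^ 2) := by
  have hsum : ∀ (N : Seminorm ℂ E) {k : ℕ} (y : Fin k → E) (τ : Fin k → ℝ) (T : ℝ), 0 < T →
      (∀ a, 0 < τ a) → (∀ a, N (y a) ≤ τ a) → ∀ z : Fin k → ℂ, (∀ a, ‖z a‖ = T / τ a) →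
      N (∑ a, z a • y a) ≤ k * T := by
    intro N k y τ T hT hτ0 hτ z hz
    calc N (∑ a, z a • y a) ≤ ∑ a, N (z a • y a) := 
        Finset.le_sum_of_subadditive N (map_zero N).le (map_add_le_add N) _ _
      _ ≤ ∑ _a : Fin k, T := by
        refine Finset.sum_le_sum fun a _ => ?_
        rw [map_smul_eq_mul, hz]
        calc T / τ a * N (y a) ≤ T / τ a * τ a :=
              mul_le_mul_of_nonneg_left (hτ a) (div_nonneg hT.le (hτ0 a).le)
          _ = T := div_mul_cancel₀ _ (hτ0 a).ne'
      _ = k * T := by simp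
  have hW₁ := hw₁0 (K₁ * (l * R) ^ 2) (by positivity)
  have hW₂ := hw₂0 (K₂ * (m * S) ^ 2) (by positivity)
  set W := C * w₁ (K₁ * (l * R) ^ 2) * w₂ (K₂ * (m * S) ^ 2) with hW
  have hW0 : 0 ≤ W := by positivity
  have hD := norm_mixedDeriv_le f (fun i => slotEmbedding E i (x i))
    (R := Sum.elim (fun a => R / ρ a) (fun b => S / σ b)) (M := Real.sqrt W)
    (by rintro (a | b)
        · exact div_pos hR (hρ0 a)
        · exact div_pos hS (hσ0 b)) fun z hz => by
      have hz' : ∑ i, z i • slotEmbedding E i (x i) =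
          (∑ a, z (Sum.inl a) • x (Sum.inl a), ∑ b, z (Sum.inr b) • x (Sum.inr b)) := by
        rw [Fintype.sum_sum_type]
        ext <;> simp [slotEmbedding, Prod.fst_sum, Prod.snd_sum]
      rw [hz']
      refine Real.le_sqrt_of_sq_le ((hf _ _).trans ?_)
      have h1 := hsum N₁ (fun a => x (Sum.inl a)) ρ R hR hρ0 hρ (fun a => z (Sum.inl a))
        fun a => hz (Sum.inl a)
      have h2 := hsum N₂ (fun b => x (Sum.inr b)) σ S hS hσ0 hσ (fun b => z (Sum.inr b))
        fun b => hz (Sum.inr b)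
      have h3 := hw₁ (a := K₁ * N₁ (∑ a, z (Sum.inl a) • x (Sum.inl a)) ^ 2)
        (b := K₁ * (l * R) ^ 2) (Set.mem_Ici.2 (by positivity)) (Set.mem_Ici.2 (by positivity))
        (by gcongr)
      have h4 := hw₂ (a := K₂ * N₂ (∑ b, z (Sum.inr b) • x (Sum.inr b)) ^ 2)
        (b := K₂ * (m * S) ^ 2) (Set.mem_Ici.2 (by positivity)) (Set.mem_Ici.2 (by positivity))
        (by gcongr)
      exact mul_le_mul (mul_le_mul_of_nonneg_left h3 hC) h4 (hw₂0 _ (by positivity))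
        (by positivity)
  rw [Fintype.prod_sum_type] at hD
  simp only [Sum.elim_inl, Sum.elim_inr, Finset.prod_div_distrib, Finset.prod_const,
    Finset.card_univ, Fintype.card_fin] at hD
  have hP : 0 < ∏ a, ρ a := Finset.prod_pos fun a _ => hρ0 a
  have hQ : 0 < ∏ b, σ b := Finset.prod_pos fun b _ => hσ0 b
  rw [taylorKernel_apply, norm_mul, norm_mul, norm_inv, norm_inv, Complex.norm_natCast,
    Complex.norm_natCast, mul_pow]
  calc ((l.factorial : ℝ)⁻¹ * (m.factorial : ℝ)⁻¹) ^ 2 *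
        ‖mixedDeriv (Fin l ⊕ Fin m) f fun i => slotEmbedding E i (x i)‖ ^ 2
      ≤ ((l.factorial : ℝ)⁻¹ * (m.factorial : ℝ)⁻¹) ^ 2 *
        (Real.sqrt W / (R ^ l / (∏ a, ρ a) * (S ^ m / ∏ b, σ b))) ^ 2 := by gcongr
    _ = _ := by
      rw [div_pow, Real.sq_sqrt hW0, hW]
      have hl : (l.factorial : ℝ) ≠ 0 := by positivity
      have hm : (m.factorial : ℝ) ≠ 0 := by positivity
      field_simp

theorem WhiteNoise.legendre_nonneg {u : ℝ → ℝ} (hu : ∀ r, 0 ≤ r → 0 ≤ u r) (t : ℝ) :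
    0 ≤ WhiteNoise.legendre u t := by
  refine Real.sInf_nonneg ?_
  rintro _ ⟨r, hr, rfl⟩
  have hr' : (0 : ℝ) < r := hr
  exact div_nonneg (hu r hr'.le) (by positivity)

theorem norm_taylorKernel_sq_le {f : entireSubmodule (E × E)} {N₁ N₂ : Seminorm ℂ E}
    {w₁ w₂ : ℝ → ℝ} (hw₁ : MonotoneOn w₁ (Set.Ici 0)) (hw₂ : MonotoneOn w₂ (Set.Ici 0))
    (hw₁0 : ∀ r, 0 ≤ r → 0 ≤ w₁ r) (hw₂0 : ∀ r, 0 ≤ r → 0 ≤ w₂ r)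
    {C K₁ K₂ : ℝ} (hC : 0 ≤ C) (hK₁ : 0 ≤ K₁) (hK₂ : 0 ≤ K₂)
    (hf : ∀ ξ η, ‖(f : E × E → ℂ) (ξ, η)‖ ^ 2 ≤ C * w₁ (K₁ * N₁ ξ ^ 2) * w₂ (K₂ * N₂ η ^ 2))
    {l m : ℕ} (x : Fin l ⊕ Fin m → E) :
    ‖taylorKernel f l m x‖ ^ 2 ≤
      C * (∏ a, N₁ (x (Sum.inl a))) ^ 2 * (∏ b, N₂ (x (Sum.inr b))) ^ 2 *
        ((K₁ * Real.exp 1 ^ 2) ^ l * WhiteNoise.legendre w₁ l) *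
        ((K₂ * Real.exp 1 ^ 2) ^ m * WhiteNoise.legendre w₂ m) := by
  have hL₁ := WhiteNoise.legendre_nonneg hw₁0 l
  have hε : ∀ ε : ℝ, 0 < ε → ‖taylorKernel f l m x‖ ^ 2 ≤
      C * (∏ a, (N₁ (x (Sum.inl a)) + ε)) ^ 2 * (∏ b, (N₂ (x (Sum.inr b)) + ε)) ^ 2 *
        ((K₁ * Real.exp 1 ^ 2) ^ l * WhiteNoise.legendre w₁ l) *
        ((K₂ * Real.exp 1 ^ 2) ^ m * WhiteNoise.legendre w₂ m) := by
    intro ε hε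
    -- The two infima are taken one at a time, the other factor being a nonnegative constant. The
    -- majorants are the seminorms plus ε, and ε → 0 at the end.
    refine WhiteNoise.le_mul_legendre hw₂ hw₂0 hK₂ (by positivity) m fun S hS => ?_
    have hW₂ := hw₂0 (K₂ * (m * S) ^ 2) (by positivity)
    rw [mul_right_comm]
    refine WhiteNoise.le_mul_legendre hw₁ hw₁0 hK₁ (by positivity) l fun R hR => ?_
    rw [mul_right_comm]
    exact norm_taylorKernel_sq_le_of_radii hw₁ hw₂ hw₁0 hw₂0 hC hK₁ hK₂ hf x
      (fun a => by positivity) (fun b => by positivity) (fun a => by linarith)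
      (fun b => by linarith) hR hS
  have hcont : Continuous fun ε : ℝ =>
      C * (∏ a, (N₁ (x (Sum.inl a)) + ε)) ^ 2 * (∏ b, (N₂ (x (Sum.inr b)) + ε)) ^ 2 *
        ((K₁ * Real.exp 1 ^ 2) ^ l * WhiteNoise.legendre w₁ l) *
        ((K₂ * Real.exp 1 ^ 2) ^ m * WhiteNoise.legendre w₂ m) := by fun_prop
  have hlim := (hcont.tendsto 0).mono_left (nhdsWithin_le_nhds (s := Set.Ioi 0))
  simp only [add_zero] at hlim
  refine ge_of_tendsto hlim ?_
  filter_upwards [self_mem_nhdsWithin] with ε h using hε ε h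

end TaylorKernel

/-! ### The test space -/

namespace WhiteNoise

variable {H : Type*} [NormedAddCommGroup H] [InnerProductSpace ℝ H]

instance (e : HilbertBasis ℕ ℝ H) (lam : ℕ → ℝ) : IsTopologicalAddGroup (TestSpaceC e lam) :=
  (withSeminorms_normP e lam).topologicalAddGroup

instance (e : HilbertBasis ℕ ℝ H) (lam : ℕ → ℝ) : ContinuousSMul ℂ (TestSpaceC e lam) :=
  (withSeminorms_normP e lam).continuousSMul

theorem normP_basisC (e : HilbertBasis ℕ ℝ H) {lam : ℕ → ℝ} (hlam : ∀ j, 0 < lam j) (p : ℝ≥0)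
    (j : ℕ) : normP e lam p (basisC e lam j) = lam j ^ (p : ℝ) := by
  have h : powC e lam p (basisC e lam j) = lp.single 2 j ((lam j ^ (p : ℝ) : ℝ) : ℂ) := by
    refine (show powC e lam p (basisC e lam j) =
      (1 : ℂ) • powReal e lam p ⟨e j, basis_mem_testSpace e lam j⟩ from
        LinearMap.liftBaseChange_tmul _ _ _ _).trans ?_
    rw [one_smul]
    ext i
    simp only [powReal, LinearMap.coe_mk, AddHom.coe_mk, e.repr_self]
    by_cases hij : i = j
    · subst hij
      simp
    · simp [lp.single_apply, hij]
  change ‖powC e lam p (basisC e lam j)‖ = _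
  rw [h, lp.norm_single two_pos, Complex.norm_real,
    Real.norm_of_nonneg (Real.rpow_pos_of_pos (hlam j) _).le]

/-- The weighted Hilbert-Schmidt norm of a kernel which is bounded by the norms `|·|_p`. -/
theorem Kernel.normSq_le {e : HilbertBasis ℕ ℝ H} {lam : ℕ → ℝ} (hlam : ∀ j, 0 < lam j) {l m : ℕ}
    (κ : Kernel e lam l m) {p₁ p₂ q₁ q₂ : ℝ≥0} {B : ℝ} (hB0 : 0 ≤ B)
    (hB : ∀ x, ‖κ x‖ ^ 2 ≤ B * (∏ a, normP e lam p₁ (x (Sum.inl a))) ^ 2 *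
      (∏ b, normP e lam p₂ (x (Sum.inr b))) ^ 2)
    (h₁ : InclusionIsHS lam q₁ p₁) (h₂ : InclusionIsHS lam q₂ p₂) :
    κ.normSq (-(q₁ : ℝ)) (-(q₂ : ℝ)) ≤ ENNReal.ofReal
      (B * inclusionHSNormSq lam q₁ p₁ ^ l * inclusionHSNormSq lam q₂ p₂ ^ m) := by
  -- The weight λ^(-2q) meets |e_j|_p² = λ^(2p), which leaves the general term of the
  -- Hilbert–Schmidt sum.
  have hpow : ∀ (p q : ℝ) {k : ℕ} (i : Fin k → ℕ),
      (∏ a, lam (i a) ^ (-q)) ^ 2 * (∏ a, lam (i a) ^ p) ^ 2 =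
        ∏ a, lam (i a) ^ (-2 * (q - p)) := by
    intro p q k i
    rw [← mul_pow, ← Finset.prod_mul_distrib, ← Finset.prod_pow]
    refine Finset.prod_congr rfl fun a _ => ?_
    rw [← Real.rpow_add (hlam _), ← Real.rpow_mul_natCast (hlam _).le]
    congr 1
    push_cast
    ring
  have hnn : ∀ (s : ℝ) (j : ℕ), 0 ≤ lam j ^ s := fun s j => (Real.rpow_pos_of_pos (hlam j) s).le
  have hsum : ∀ {p q : ℝ≥0}, InclusionIsHS lam q p → ∀ k : ℕ,
      ∑' i : Fin k → ℕ, ENNReal.ofReal (∏ a, lam (i a) ^ (-2 * ((q : ℝ) - p))) =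
        ENNReal.ofReal (inclusionHSNormSq lam q p ^ k) := by
    intro p q h k
    rw [inclusionHSNormSq, ENNReal.ofReal_pow (tsum_nonneg fun j => hnn _ j),
      ENNReal.ofReal_tsum_of_nonneg (fun j => hnn _ j) h, ← ENNReal.tsum_prod_fin]
    exact tsum_congr fun i => ENNReal.ofReal_prod_of_nonneg fun a _ => hnn _ _
  have hHS : ∀ p q : ℝ, 0 ≤ inclusionHSNormSq lam q p := fun p q => tsum_nonneg fun j => hnn _ j
  calc κ.normSq (-(q₁ : ℝ)) (-(q₂ : ℝ))
      ≤ ∑' (i : Fin l → ℕ) (j : Fin m → ℕ), ENNReal.ofReal B *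
        ENNReal.ofReal (∏ a, lam (i a) ^ (-2 * ((q₁ : ℝ) - p₁))) *
        ENNReal.ofReal (∏ b, lam (j b) ^ (-2 * ((q₂ : ℝ) - p₂))) := by
        refine ENNReal.tsum_le_tsum fun i => ENNReal.tsum_le_tsum fun j => ?_
        rw [← ENNReal.ofReal_mul hB0,
          ← ENNReal.ofReal_mul (mul_nonneg hB0 (Finset.prod_nonneg fun a _ => hnn _ _))]
        refine ENNReal.ofReal_le_ofReal ?_
        have h := hB (Sum.elim (fun a => basisC e lam (i a)) (fun b => basisC e lam (j b)))
        simp only [Sum.elim_inl, Sum.elim_inr, normP_basisC e hlam] at h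
        rw [← hpow p₁ q₁ i, ← hpow p₂ q₂ j, mul_pow, mul_pow]
        refine (mul_le_mul_of_nonneg_left h (by positivity)).trans (le_of_eq ?_)
        ring
    _ = _ := by
        simp only [ENNReal.tsum_mul_left, ENNReal.tsum_mul_right]
        rw [hsum h₁, hsum h₂, ← ENNReal.ofReal_mul hB0,
          ← ENNReal.ofReal_mul (mul_nonneg hB0 (pow_nonneg (hHS _ _) _))]

end WhiteNoise
theorem lemma3p1 {H : Type*} [NormedAddCommGroup H] [InnerProductSpace ℝ H] [CompleteSpace H]
    (e : HilbertBasis ℕ ℝ H) (lam : ℕ → ℝ) (hlam : ∀ j, 0 < lam j)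
    (u₁ u₂ : ℝ → ℝ) (hu₁ : WhiteNoise.IsCPlusHalf u₁) (hu₂ : WhiteNoise.IsCPlusHalf u₂)
    (F : WhiteNoise.TestSpaceC e lam × WhiteNoise.TestSpaceC e lam → ℂ)
    (hF : WhiteNoise.IsEntire e lam F)
    (C K₁ K₂ : ℝ) (hK₁ : 0 ≤ K₁) (hK₂ : 0 ≤ K₂)
    (p₁ p₂ : ℝ≥0) (hp₁ : 0 < p₁) (hp₂ : 0 < p₂)
    (hgrowth : ∀ ξ η : WhiteNoise.TestSpaceC e lam,
      ‖F (ξ, η)‖ ^ 2 ≤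
        C * WhiteNoise.dualLegendre u₁ (K₁ * WhiteNoise.normP e lam p₁ ξ ^ 2)
          * WhiteNoise.dualLegendre u₂ (K₂ * WhiteNoise.normP e lam p₂ η ^ 2)) :
    ∃ κ : (l m : ℕ) → WhiteNoise.Kernel e lam l m,
      (∀ l m, (κ l m).IsSymm) ∧
      (∀ ξ η : WhiteNoise.TestSpaceC e lam,
        HasSum (fun n : ℕ × ℕ => (κ n.1 n.2).pair ξ η) (F (ξ, η))) ∧
      ∀ q₁ q₂ : ℝ≥0, p₁ < q₁ → p₂ < q₂ →
        WhiteNoise.InclusionIsHS lam q₁ p₁ → WhiteNoise.InclusionIsHS lam q₂ p₂ →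
        K₁ * Real.exp 1 ^ 2 * WhiteNoise.inclusionHSNormSq lam q₁ p₁ < 1 →
        K₂ * Real.exp 1 ^ 2 * WhiteNoise.inclusionHSNormSq lam q₂ p₂ < 1 →
        ∀ l m : ℕ, (κ l m).normSq (-(q₁ : ℝ)) (-(q₂ : ℝ)) ≤ ENNReal.ofReal
          (C * (K₁ * Real.exp 1 ^ 2 * WhiteNoise.inclusionHSNormSq lam q₁ p₁) ^ l
            * (K₂ * Real.exp 1 ^ 2 * WhiteNoise.inclusionHSNormSq lam q₂ p₂) ^ m
            * WhiteNoise.legendre (WhiteNoise.dualLegendre u₁) (l : ℝ)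
            * WhiteNoise.legendre (WhiteNoise.dualLegendre u₂) (m : ℝ)) := by
  have hu₁0 : ∀ r, 0 ≤ r → 0 ≤ WhiteNoise.dualLegendre u₁ r := fun r hr =>
    (hu₁.dualLegendre_pos hr).le
  have hu₂0 : ∀ r, 0 ≤ r → 0 ≤ WhiteNoise.dualLegendre u₂ r := fun r hr =>
    (hu₂.dualLegendre_pos hr).le
  -- The sign of `C` is forced by the growth bound at the origin, since dual Legendre transforms are
  -- strictly positive.
  have hC : 0 ≤ C := by
    have h := (sq_nonneg _).trans (hgrowth 0 0)
    have h₁ := hu₁.dualLegendre_pos (r := K₁ * WhiteNoise.normP e lam p₁ 0 ^ 2) (by positivity)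
    have h₂ := hu₂.dualLegendre_pos (r := K₂ * WhiteNoise.normP e lam p₂ 0 ^ 2) (by positivity)
    exact nonneg_of_mul_nonneg_left (nonneg_of_mul_nonneg_left h h₂) h₁
  let f : entireSubmodule (WhiteNoise.TestSpaceC e lam × WhiteNoise.TestSpaceC e lam) := ⟨F, hF⟩
  let B : ℕ → ℕ → ℝ := fun l m =>
    C * ((K₁ * Real.exp 1 ^ 2) ^ l * WhiteNoise.legendre (WhiteNoise.dualLegendre u₁) l) *
      ((K₂ * Real.exp 1 ^ 2) ^ m * WhiteNoise.legendre (WhiteNoise.dualLegendre u₂) m)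
  have hB0 : ∀ l m, 0 ≤ B l m := fun l m => by
    have h₁ := WhiteNoise.legendre_nonneg hu₁0 l
    have h₂ := WhiteNoise.legendre_nonneg hu₂0 m
    positivity
  have hB : ∀ l m x, ‖taylorKernel f l m x‖ ^ 2 ≤
      B l m * (∏ a, WhiteNoise.normP e lam p₁ (x (Sum.inl a))) ^ 2 *
        (∏ b, WhiteNoise.normP e lam p₂ (x (Sum.inr b))) ^ 2 := fun l m x =>
    (norm_taylorKernel_sq_le hu₁.dualLegendre_monotoneOn hu₂.dualLegendre_monotoneOn hu₁0 hu₂0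
      hC hK₁ hK₂ hgrowth x).trans (le_of_eq (by ring))
  have hcont : ∀ l m, Continuous (taylorKernel f l m) := fun l m => by
    refine (taylorKernel f l m).continuous_of_seminorm_bound
      (Sum.elim (fun _ => WhiteNoise.normP e lam p₁) fun _ => WhiteNoise.normP e lam p₂)
      ?_ (Real.sqrt (B l m)) fun x => ?_
    · rintro (a | b)
      · exact (WhiteNoise.withSeminorms_normP e lam).continuous_seminorm p₁
      · exact (WhiteNoise.withSeminorms_normP e lam).continuous_seminorm p₂
    · rw [Fintype.prod_sum_type]
      refine le_of_sq_le_sq ((hB l m x).trans (le_of_eq ?_)) ?_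
      · simp only [Sum.elim_inl, Sum.elim_inr]
        rw [mul_pow, mul_pow, Real.sq_sqrt (hB0 l m), mul_assoc]
      · exact mul_nonneg (Real.sqrt_nonneg _) (mul_nonneg
          (Finset.prod_nonneg fun a _ => apply_nonneg _ _)
          (Finset.prod_nonneg fun b _ => apply_nonneg _ _))
  refine ⟨fun l m => ⟨taylorKernel f l m, hcont l m⟩,
    fun l m σ τ x => taylorKernel_comp_sumMap f σ τ x, fun ξ η => hasSum_taylorKernel f ξ η, ?_⟩
  intro q₁ q₂ _ _ h₁ h₂ _ _ l m
  refine (WhiteNoise.Kernel.normSq_le hlam _ (hB0 l m) (hB l m) h₁ h₂).trans (le_of_eq ?_)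
  congr 1
  simp only [B, mul_pow]
  ring
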